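/- Model. The synchronous clique consists of $n$ nodes joined pairwise by bidirectional links. Each node has $n-1$ ports, which lead to the $n-1$ other nodes in an arbitrary way fixed by a port mapping: a fixed-point-free involution $p$ on pairs (node, port) such that different ports of a node lead to different other nodes; $p(u,i)=(v,j)$ means that a message sent by $u$ over port $i$ arrives at $v$ over port $j$. The nodes have pairwise different IDs from a set $U\subseteq\mathbb Z$ (the ID universe); initially a node knows only $n$ and its own ID. All nodes start in round $1$. In each round $r\ge 1$, every node that has not terminated in an earlier round receives the messages sent to it in round $r-1$ (none if $r=1$), performs an arbitrary deterministic local computation, and sends messages of arbitrary size, at most one over each port; it may terminate in this round, with an irrevocable output bit. So an output produced in round $r$ depends only on messages sent in rounds before $r$. An algorithm elects a leader in $T$ rounds over $U$ if, for every assignment of pairwise different IDs from $U$ to the nodes and every port mapping, all nodes have terminated by round $T$ and exactly one of them outputs $1$. Its messages in an execution are all messages sent by all nodes (in rounds $1,\dots,T$). Theorem. There are an integer $N_0$ and a constant $c>0$ such that the following holds for every power of two $n\ge N_0$, every set $U\subseteq\mathbb Z$ with $|U|\ge 2n\log_2 n+n$, and every deterministic algorithm for the synchronous clique of $n$ nodes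 with simultaneous wake-up. (1) Let $f:\mathbb N\to\mathbb R$ be any function (for example an increasing one) with $f(n)>1$. If the algorithm elects a leader over $U$ in $T$ rounds, and sends at most $n\cdot f(n)$ messages for every ID assignment from $U$ and every port mapping, then $$T>\frac{\log_2 n-1}{\log_2 f(n)+1}+1 .$$ (2) Consequently, for every integer $k\ge 2$, if the algorithm elects a leader over $U$ in $k$ rounds, then there are an ID assignment from $U$ and a port mapping for which it sends at least $$c\left(\frac n2\right)^{1+\frac1{k-1}}$$ messages; that is, every deterministic $k$-round algorithm requires $\Omega\bigl((n/2)^{1+1/(k-1)}\bigr)$ messages. -/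

import Mathlib

/-!
Deterministic leader election in the synchronous clique on `n` nodes with simultaneous wake-up,
in the clean network model: a node initially knows only `n` and its own ID, and it addresses its
links through `n - 1` ports whose assignment to the other nodes is arbitrary.
-/

namespace CliqueElection

universe u v

/-- A port mapping of the clique on the node set `Fin n`: `link (u, i) = (v, j)` means that a
message sent by `u` over its port `i` is received by `v` over its port `j`. Links are bidirectional,
and the `n - 1` ports of `u` lead to pairwise different nodes other than `u`. -/
structure PortMapping (n : ℕ) where
  link : Fin n × Fin (n - 1) → Fin n × Fin (n - 1)
  link_link : ∀ x, link (link x) = x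
  ne_self : ∀ u i, (link (u, i)).1 ≠ u
  injective_dest : ∀ u, Function.Injective fun i => (link (u, i)).1

/-- A deterministic algorithm for `n` nodes, with arbitrary local states and messages of
unrestricted size. A node with ID `x` starts in the state `start x`. In a round, a node in state `s`
that finds the messages `inbox` at its ports (`none` at a port where nothing has arrived) moves to
the state `(step s inbox).1` and sends the message `(step s inbox).2 i` over port `i`
(`none`: no message is sent over `i`). A node has terminated once `output` of its state is a bit;
the bit `true` says that the node is the leader. -/
structure Algorithm (n : ℕ) where
  State : Type u
  Msg : Type v
  start : ℤ → State
  step : State → (Fin (n - 1) → Option Msg) → State × (Fin (n - 1) → Option Msg)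
  output : State → Option Bool

variable {n : ℕ}

/-- An assignment of pairwise different IDs from the universe `U` to the nodes. -/
def ValidIDs (U : Set ℤ) (ids : Fin n → ℤ) : Prop :=
  Function.Injective ids ∧ ∀ w, ids w ∈ U

namespace Algorithm

/-- The configuration after `r` rounds: for each node its state, and the messages that it sent in
round `r`, by port. All nodes start in round `1`. In round `r + 1` every node that has not terminated
receives the messages sent to it in round `r`, changes its state, and sends its messages of
round `r + 1`; a node that has terminated in an earlier round keeps its state and is silent. -/
def config (A : Algorithm.{u, v} n) (ids : Fin n → ℤ) (p : PortMapping n) :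
    ℕ → Fin n → A.State × (Fin (n - 1) → Option A.Msg)
  | 0 => fun w => (A.start (ids w), fun _ => none)
  | r + 1 => fun w =>
      if (A.output (config A ids p r w).1).isSome then
        ((config A ids p r w).1, fun _ => none)
      else
        A.step (config A ids p r w).1 fun i =>
          (config A ids p r (p.link (w, i)).1).2 (p.link (w, i)).2

/-- What the node `w` has output by round `r` (`none`: it has not terminated by round `r`). -/
def outputBy (A : Algorithm.{u, v} n) (ids : Fin n → ℤ) (p : PortMapping n) (r : ℕ) (w : Fin n) :
    Option Bool :=
  A.output (A.config ids p r w).1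

/-- The number of messages sent by all nodes in round `r`. -/
def messagesIn (A : Algorithm.{u, v} n) (ids : Fin n → ℤ) (p : PortMapping n) (r : ℕ) : ℕ :=
  (Finset.univ.filter fun x : Fin n × Fin (n - 1) =>
    ((A.config ids p r x.1).2 x.2).isSome = true).card

/-- The number of messages sent by all nodes in the rounds `1, …, R`. If every node has terminated
by round `R`, these are all messages of the execution. -/
def messages (A : Algorithm.{u, v} n) (ids : Fin n → ℤ) (p : PortMapping n) (R : ℕ) : ℕ :=
  ∑ r ∈ Finset.Icc 1 R, A.messagesIn ids p r

/-- The algorithm solves (implicit) leader election over the ID universe `U` and terminates in `T`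
rounds: for all valid IDs and all port mappings, every node has terminated by round `T`, and exactly
one node outputs that it is the leader. -/
def ElectsLeaderIn (A : Algorithm.{u, v} n) (U : Set ℤ) (T : ℕ) : Prop :=
  ∀ (ids : Fin n → ℤ) (p : PortMapping n), ValidIDs U ids →
    (∀ w, (A.outputBy ids p T w).isSome = true) ∧ ∃! w, A.outputBy ids p T w = some true

end Algorithm

end CliqueElection

/-! Only as many messages as the budget allows can leave a small group of nodes, and an adversary
who chooses the ports can keep them inside a slightly larger group. A cluster is a set of IDs wired
internally, with its other ports dead; it is isolated through round `r` if it never uses a dead port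
by then. Disjoint isolated clusters can be wired together without noticing each other through round
`r + 1`, because what a node does in round `r + 1` depends only on messages sent by round `r`
(`run_eq_of_isolated`).

Suppose every execution sends at most `n * f` messages, and take an integer `b > f`. Start with
singletons, isolated through round `0`. Among clusters of size `σ` isolated through round `r`, those
sending more than `σ * f` messages by round `r + 1` cover fewer than `n` IDs, since otherwise `n /
σ` of them would form an execution over budget (`card_mul_lt`). Merge the others in groups of `b`.
Each sends fewer than `b * σ` messages, so every used port of a node can be directed to one of the
other nodes of the merged cluster, which is then isolated through round `r + 1`
(`exists_isolated_sup`). A round costs at most `2 * n` IDs: the expensive clusters and an incomplete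
last group (`exists_succ`).

If `b ^ (T - 1)` divides `n` with quotient `m ≥ 2`, enough IDs survive for `m + 1` clusters isolated
through round `T - 1`. Any `m` of them form a clique in which each behaves through round `T` as it
does alone, so any `m` of them contain exactly one leader in total. Hence all `m + 1` clusters have
the same number of leaders, and `m` times that number is `1`, which is impossible (`card_le`). With
`b` the power of two in `(f, 2 * f]` this is (1). Part (2) is (1) for a suitable `f > 1`, and where
no such `f` exists, a direct linear bound (`exists_linear_messages`). -/

namespace CliqueElection

universe u v

/-! ### Executions on sets of IDs, and isolation -/

variable {n : ℕ}

/-- `P` attaches different ports of each node of `S` to different other nodes of `S`. Nodes are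
identified with their IDs: `P x y` is the port of `x` that leads to `y`. -/
def IsWiring (P : ℤ → ℤ → Fin (n - 1)) (S : Finset ℤ) : Prop :=
  ∀ x ∈ S, Set.InjOn (P x) (S.erase x : Finset ℤ)

/-- An injective port assignment on `D` extends to a larger set so as to cover a prescribed set of
ports. -/
theorem exists_injOn_extension {α β : Type*} [DecidableEq α] [Fintype β] [DecidableEq β]
    (g : α → β) {D V : Finset α} {R : Finset β} (hDV : D ⊆ V) (hg : Set.InjOn g (D : Set α))
    (hR : ∀ y ∈ D, g y ∈ R) (hRV : R.card ≤ V.card) (hV : V.card ≤ Fintype.card β) :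
    ∃ h : α → β, Set.InjOn h (V : Set α) ∧ (∀ y ∈ D, h y = g y) ∧ ∀ i ∈ R, ∃ y ∈ V, h y = i := by
  -- The extension will be a bijection from `V` onto `R'`: it is `g` on `D` and an arbitrary
  -- matching of `V \ D` with the rest of `R'`.
  obtain ⟨R', hRR', hR'⟩ := Finset.exists_superset_card_eq hRV hV
  have hsub : D.image g ⊆ R' := fun i hi => by
    obtain ⟨y, hy, rfl⟩ := Finset.mem_image.1 hi
    exact hRR' (hR y hy)
  have hcard : (V \ D).card = (R' \ D.image g).card := by
    rw [Finset.card_sdiff_of_subset hDV, Finset.card_sdiff_of_subset hsub,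
      Finset.card_image_of_injOn hg, hR']
  let e := Finset.equivOfCardEq hcard
  have he : ∀ y (hy : y ∈ V \ D), (e ⟨y, hy⟩ : β) ∈ R' ∧ (e ⟨y, hy⟩ : β) ∉ D.image g :=
    fun y hy => Finset.mem_sdiff.1 (e ⟨y, hy⟩).2
  refine ⟨fun y => if hy : y ∈ V \ D then e ⟨y, hy⟩ else g y, ?_, ?_, ?_⟩
  · have key : ∀ y ∈ V, y ∉ V \ D → y ∈ D := by
      intro y hy hy'; by_contra h; exact hy' (Finset.mem_sdiff.2 ⟨hy, h⟩)
    intro y hy z hz hyz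
    by_cases h1 : y ∈ V \ D <;> by_cases h2 : z ∈ V \ D <;> simp only [h1, h2, dite_true,
      dite_false] at hyz
    · simpa using e.injective (Subtype.ext hyz)
    · exact absurd (hyz ▸ Finset.mem_image_of_mem g (key z hz h2)) (he y h1).2
    · exact absurd (hyz ▸ Finset.mem_image_of_mem g (key y hy h1)) (he z h2).2
    · exact hg (key y hy h1) (key z hz h2) hyz
  · intro y hy
    simp [hy]
  · intro i hi
    by_cases h : i ∈ D.image g
    · obtain ⟨y, hy, rfl⟩ := Finset.mem_image.1 h
      exact ⟨y, hDV hy, by simp [hy]⟩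
    · have hi' : i ∈ R' \ D.image g := Finset.mem_sdiff.2 ⟨hRR' hi, h⟩
      refine ⟨e.symm ⟨i, hi'⟩, (Finset.mem_sdiff.1 (e.symm ⟨i, hi'⟩).2).1, ?_⟩
      have hmem := (e.symm ⟨i, hi'⟩).2
      simp only [hmem, dite_true, Subtype.coe_eta, Equiv.apply_symm_apply]

namespace Algorithm

variable (A : Algorithm.{u, v} n)

open Classical in
/-- The execution on the set `S` of IDs whose links are given by `P`; ports that lead to no node of
`S` are dead. -/
noncomputable def run (P : ℤ → ℤ → Fin (n - 1)) (S : Finset ℤ) :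
    ℕ → ℤ → A.State × (Fin (n - 1) → Option A.Msg)
  | 0 => fun x => (A.start x, fun _ => none)
  | r + 1 => fun x =>
      if (A.output (run P S r x).1).isSome then ((run P S r x).1, fun _ => none)
      else
        A.step (run P S r x).1 fun i =>
          if h : ∃ y ∈ S, y ≠ x ∧ P x y = i then
            (run P S r h.choose).2 (P h.choose x)
          else none

variable {A} {P Q : ℤ → ℤ → Fin (n - 1)} {S C : Finset ℤ}

-- Injectivity of `P x` pins down the sender chosen in `run`.
open Classical in
theorem inbox_of_mem (m : ℤ → Fin (n - 1) → Option A.Msg) (hP : IsWiring P S) {x y : ℤ}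
    (hx : x ∈ S) (hy : y ∈ S) (hyx : y ≠ x) :
    (if h : ∃ z ∈ S, z ≠ x ∧ P x z = P x y then m h.choose (P h.choose x) else none) =
      m y (P y x) := by
  have h : ∃ z ∈ S, z ≠ x ∧ P x z = P x y := ⟨y, hy, hyx, rfl⟩
  have hc : h.choose = y :=
    hP x hx (by simpa using ⟨h.choose_spec.1, h.choose_spec.2.1⟩) (by simpa using ⟨hy, hyx⟩)
      h.choose_spec.2.2
  rw [dif_pos h, hc]

/-- A round depends only on the previous state and on the messages received. -/
theorem run_succ_congr (hP : IsWiring P C) (hQ : IsWiring Q S) {r : ℕ} {x : ℤ} (hxC : x ∈ C)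
    (hxS : x ∈ S) (hx : (A.run Q S r x).1 = (A.run P C r x).1)
    (hPQ : ∀ y ∈ C, y ≠ x → ((A.run P C r y).2 (P y x)).isSome →
      y ∈ S ∧ Q x y = P x y ∧ (A.run Q S r y).2 (Q y x) = (A.run P C r y).2 (P y x))
    (hQP : ∀ y ∈ S, y ≠ x → ((A.run Q S r y).2 (Q y x)).isSome →
      y ∈ C ∧ P x y = Q x y ∧ (A.run P C r y).2 (P y x) = (A.run Q S r y).2 (Q y x)) :
    A.run Q S (r + 1) x = A.run P C (r + 1) x := by
  classical
  simp only [run, hx]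
  congr 2
  funext i
  apply Option.ext
  intro a
  constructor
  · intro h
    by_cases hi : ∃ y ∈ S, y ≠ x ∧ Q x y = i
    · obtain ⟨y, hy, hyx, rfl⟩ := hi
      rw [inbox_of_mem (fun z => (A.run Q S r z).2) hQ hxS hy hyx] at h
      obtain ⟨h1, h2, h3⟩ := hQP y hy hyx (by rw [h]; rfl)
      rw [← h2, inbox_of_mem (fun z => (A.run P C r z).2) hP hxC h1 hyx, h3, h]
    · rw [dif_neg hi] at h; cases h
  · intro h
    by_cases hi : ∃ y ∈ C, y ≠ x ∧ P x y = i
    · obtain ⟨y, hy, hyx, rfl⟩ := hi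
      rw [inbox_of_mem (fun z => (A.run P C r z).2) hP hxC hy hyx] at h
      obtain ⟨h1, h2, h3⟩ := hPQ y hy hyx (by rw [h]; rfl)
      rw [← h2, inbox_of_mem (fun z => (A.run Q S r z).2) hQ hxS h1 hyx, h3, h]
    · rw [dif_neg hi] at h; cases h

variable (A)

/-- Through round `r`, all messages of the execution on `C` stay within `C`. -/
def Isolated (P : ℤ → ℤ → Fin (n - 1)) (C : Finset ℤ) (r : ℕ) : Prop :=
  ∀ s ≤ r, ∀ x ∈ C, ∀ i, ((A.run P C s x).2 i).isSome → ∃ y ∈ C, y ≠ x ∧ P x y = i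

/-- In the execution on `C`, a message crosses the link from `x` to `y` by round `r`. -/
def Crosses (P : ℤ → ℤ → Fin (n - 1)) (C : Finset ℤ) (r : ℕ) (x y : ℤ) : Prop :=
  ∃ s ≤ r, ((A.run P C s x).2 (P x y)).isSome

variable {A}

/-- If `S` is a union of disjoint clusters, each of them isolated through round `r`, and the wiring
of `S` respects the links that the clusters use by round `r`, then each cluster runs within `S` as
it does alone, through round `r + 1`. -/
theorem run_eq_of_isolated {𝒞 : Finset (Finset ℤ)} {P : Finset ℤ → ℤ → ℤ → Fin (n - 1)} {r : ℕ}
    (hdisj : (𝒞 : Set (Finset ℤ)).PairwiseDisjoint id) (hS : S = 𝒞.sup id)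
    (hP : ∀ C ∈ 𝒞, IsWiring (P C) C) (hiso : ∀ C ∈ 𝒞, A.Isolated (P C) C r)
    (hQ : IsWiring Q S)
    (hPQ : ∀ C ∈ 𝒞, ∀ x ∈ C, ∀ y ∈ C, y ≠ x →
      (A.Crosses (P C) C r x y ∨ A.Crosses (P C) C r y x) → Q x y = P C x y) :
    ∀ s ≤ r + 1, ∀ C ∈ 𝒞, ∀ x ∈ C, A.run Q S s x = A.run (P C) C s x := by
  have hmem : ∀ C ∈ 𝒞, ∀ x ∈ C, x ∈ S := fun C hC x hx => by
    rw [hS, Finset.mem_sup]; exact ⟨C, hC, hx⟩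
  intro s
  induction s with
  | zero => intros; rfl
  | succ s ih =>
    intro hs C hC x hx
    have ih' := ih (by omega)
    refine run_succ_congr (hP C hC) hQ hx (hmem C hC x hx) (by rw [ih' C hC x hx]) ?_ ?_
    · intro y hy hyx h
      have hc : A.Crosses (P C) C r y x := ⟨s, by omega, h⟩
      exact ⟨hmem C hC y hy, hPQ C hC x hx y hy hyx (Or.inr hc),
        by rw [ih' C hC y hy, hPQ C hC y hy x hx hyx.symm (Or.inl hc)]⟩
    · intro z hz hzx h
      rw [hS, Finset.mem_sup] at hz
      obtain ⟨C', hC', hzC'⟩ := hz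
      rw [id] at hzC'
      rw [ih' C' hC' z hzC'] at h ⊢
      -- No message enters from another cluster: the port used by `z` leads to some `y` of its own
      -- cluster, in `Q` as well, and injectivity of `Q z` forces `y = x`.
      obtain ⟨y, hy, hyz, hyP⟩ := hiso C' hC' s (by omega) z hzC' _ h
      have hc : A.Crosses (P C') C' r z y := ⟨s, by omega, by rw [hyP]; exact h⟩
      have hQy := hPQ C' hC' z hzC' y hy hyz (Or.inl hc)
      have hyx : y = x := hQ z (hmem C' hC' z hzC')
        (by simpa using ⟨hmem C' hC' y hy, hyz⟩) (by simpa using ⟨hmem C hC x hx, hzx.symm⟩)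
        (hQy.trans hyP)
      subst hyx
      have hCC : C' = C := hdisj.elim_finset hC' hC y hy hx
      subst hCC
      exact ⟨hzC', (hPQ C' hC' y hy z hzC' hzx (Or.inr hc)).symm, by rw [hyP]⟩

end Algorithm
-- Wiring isolated clusters together
namespace Algorithm

variable (A : Algorithm.{u, v} n)

/-- The number of messages that `x` sends in round `r` of the execution on `C`. -/
noncomputable def sentIn (P : ℤ → ℤ → Fin (n - 1)) (C : Finset ℤ) (r : ℕ) (x : ℤ) : ℕ :=
  (Finset.univ.filter fun i => ((A.run P C r x).2 i).isSome = true).card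

/-- The number of messages that `x` sends in the rounds `1, …, R` of the execution on `C`. -/
noncomputable def sentBy (P : ℤ → ℤ → Fin (n - 1)) (C : Finset ℤ) (R : ℕ) (x : ℤ) : ℕ :=
  ∑ r ∈ Finset.Icc 1 R, A.sentIn P C r x

variable {A} {P Q : ℤ → ℤ → Fin (n - 1)} {S C : Finset ℤ}

open Classical in
theorem card_ports_le_sentBy (R : ℕ) (x : ℤ) :
    (Finset.univ.filter fun i => ∃ s ≤ R, ((A.run P C s x).2 i).isSome = true).card ≤
      A.sentBy P C R x := by
  refine (Finset.card_le_card ?_).trans (Finset.card_biUnion_le (s := Finset.Icc 1 R)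
    (t := fun r => Finset.univ.filter fun i => ((A.run P C r x).2 i).isSome = true))
  intro i hi
  obtain ⟨s, hs, h⟩ := (Finset.mem_filter.1 hi).2
  refine Finset.mem_biUnion.2 ⟨s, Finset.mem_Icc.2 ⟨?_, hs⟩, by simpa using h⟩
  by_contra h0
  obtain rfl : s = 0 := by omega
  simp [run] at h

theorem one_le_sentBy {s R : ℕ} {x : ℤ} {i : Fin (n - 1)} (hs : s ≤ R)
    (h : ((A.run P C s x).2 i).isSome = true) : 1 ≤ A.sentBy P C R x := by
  classical
  refine le_trans ?_ (card_ports_le_sentBy R x)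
  exact Finset.card_pos.2 ⟨i, by simpa using ⟨s, hs, h⟩⟩

open Classical in
/-- The ports of `x` that are used on either side by round `R`. -/
noncomputable def usedPorts (A : Algorithm.{u, v} n) (P : ℤ → ℤ → Fin (n - 1)) (C : Finset ℤ)
    (R : ℕ) (x : ℤ) : Finset (Fin (n - 1)) :=
  (Finset.univ.filter fun i => ∃ s ≤ R, ((A.run P C s x).2 i).isSome = true) ∪
    ((C.erase x).filter fun y => A.Crosses P C R y x).image (P x)

/-- Each port used by `x` itself is paid for by a message of `x`, and each port on which `x` is
reached by a message of the node behind it. -/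
theorem card_usedPorts_le (R : ℕ) {x : ℤ} (hx : x ∈ C) :
    (A.usedPorts P C R x).card ≤ ∑ y ∈ C, A.sentBy P C R y := by
  classical
  rw [← Finset.add_sum_erase _ _ hx]
  refine (Finset.card_union_le _ _).trans (add_le_add (card_ports_le_sentBy R x) ?_)
  refine Finset.card_image_le.trans ?_
  rw [Finset.card_filter]
  refine Finset.sum_le_sum fun y _ => ?_
  split_ifs with h
  · obtain ⟨s, hs, h⟩ := h
    exact one_le_sentBy hs h
  · exact Nat.zero_le _

theorem Crosses.mono {r r' : ℕ} (h : r ≤ r') {x y : ℤ} (hc : A.Crosses P C r x y) :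
    A.Crosses P C r' x y := by
  obtain ⟨s, hs, h'⟩ := hc
  exact ⟨s, hs.trans h, h'⟩

/-- Disjoint isolated clusters that together have at most `n` nodes can be wired together so that
each runs as it does alone, and all ports that are used by round `R` lead to nodes of the union,
provided that the nodes have few enough used ports. -/
theorem exists_wiring_sup {𝒞 : Finset (Finset ℤ)} {P : Finset ℤ → ℤ → ℤ → Fin (n - 1)} {r R : ℕ}
    (hdisj : (𝒞 : Set (Finset ℤ)).PairwiseDisjoint id) (hn : (𝒞.sup id).card ≤ n) (hrR : r ≤ R)
    (hP : ∀ C ∈ 𝒞, IsWiring (P C) C) (hiso : ∀ C ∈ 𝒞, A.Isolated (P C) C r)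
    (hused : ∀ C ∈ 𝒞, ∀ x ∈ C, (A.usedPorts (P C) C R x).card < (𝒞.sup id).card) :
    ∃ Q : ℤ → ℤ → Fin (n - 1), IsWiring Q (𝒞.sup id) ∧
      (∀ s ≤ r + 1, ∀ C ∈ 𝒞, ∀ x ∈ C, A.run Q (𝒞.sup id) s x = A.run (P C) C s x) ∧
      ∀ C ∈ 𝒞, ∀ x ∈ C, ∀ i ∈ A.usedPorts (P C) C R x,
        ∃ y ∈ 𝒞.sup id, y ≠ x ∧ Q x y = i := by
  classical
  set S := 𝒞.sup id with hS
  have hsub : ∀ C ∈ 𝒞, C ⊆ S := fun C hC => Finset.le_sup (f := id) hC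
  -- The ports of different nodes can be chosen independently, since a wiring imposes no relation
  -- between `Q x y` and `Q y x`.
  have key : ∀ x ∈ S, ∃ q : ℤ → Fin (n - 1), Set.InjOn q (S.erase x : Finset ℤ) ∧
      ∀ C ∈ 𝒞, x ∈ C → (∀ y ∈ C, y ≠ x →
        (A.Crosses (P C) C r x y ∨ A.Crosses (P C) C r y x) → q y = P C x y) ∧
        ∀ i ∈ A.usedPorts (P C) C R x, ∃ y ∈ S, y ≠ x ∧ q y = i := by
    intro x hx
    obtain ⟨C, hC, hxC⟩ := Finset.mem_sup.1 (hS ▸ hx)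
    rw [id] at hxC
    have hSx : (S.erase x).card = S.card - 1 := Finset.card_erase_of_mem hx
    have hu := hused C hC x hxC
    have hR : ∀ y ∈ (C.erase x).filter fun y => A.Crosses (P C) C r x y ∨ A.Crosses (P C) C r y x,
        P C x y ∈ A.usedPorts (P C) C R x := by
      intro y hy
      obtain ⟨hy, h⟩ := Finset.mem_filter.1 hy
      rcases h with ⟨s, hs, h⟩ | h
      · exact Finset.mem_union_left _ (by simpa using ⟨s, hs.trans hrR, h⟩)
      · exact Finset.mem_union_right _ (Finset.mem_image_of_mem _
          (Finset.mem_filter.2 ⟨hy, h.mono hrR⟩))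
    -- Links used by round `r` keep their ports; the remaining ports used by round `R`, dead or not,
    -- may lead anywhere in the union. There is room because fewer than `S.card` ports are used.
    obtain ⟨q, hq, hqD, hqR⟩ := exists_injOn_extension (P C x)
      ((Finset.filter_subset _ _).trans (Finset.erase_subset_erase x (hsub C hC)))
      ((hP C hC x hxC).mono (Finset.coe_subset.2 (Finset.filter_subset _ _))) hR
      (by omega) (by rw [Fintype.card_fin]; omega)
    refine ⟨q, hq, fun C' hC' hxC' => ?_⟩
    obtain rfl : C' = C := hdisj.elim_finset hC' hC x hxC' hxC
    refine ⟨fun y hy hyx h => hqD y (by simp [hy, hyx, h]), fun i hi => ?_⟩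
    obtain ⟨y, hy, rfl⟩ := hqR i hi
    exact ⟨y, Finset.mem_of_mem_erase hy, Finset.ne_of_mem_erase hy, rfl⟩
  have : Nonempty (ℤ → Fin (n - 1)) := ⟨P ∅ 0⟩
  choose! Q hQ using key
  have hw : IsWiring Q S := fun x hx => (hQ x hx).1
  refine ⟨Q, hw, ?_, fun C hC x hx => ((hQ x (hsub C hC hx)).2 C hC hx).2⟩
  exact run_eq_of_isolated hdisj hS hP hiso hw
    fun C hC x hx => ((hQ x (hsub C hC hx)).2 C hC hx).1

/-- Clusters that are isolated through round `r` and send few messages by round `r + 1` form a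
cluster that is isolated through round `r + 1`. -/
theorem exists_isolated_sup {𝒞 : Finset (Finset ℤ)} {P : Finset ℤ → ℤ → ℤ → Fin (n - 1)} {r : ℕ}
    (hdisj : (𝒞 : Set (Finset ℤ)).PairwiseDisjoint id) (hn : (𝒞.sup id).card ≤ n)
    (hP : ∀ C ∈ 𝒞, IsWiring (P C) C) (hiso : ∀ C ∈ 𝒞, A.Isolated (P C) C r)
    (hsent : ∀ C ∈ 𝒞, ∑ x ∈ C, A.sentBy (P C) C (r + 1) x < (𝒞.sup id).card) :
    ∃ Q : ℤ → ℤ → Fin (n - 1), IsWiring Q (𝒞.sup id) ∧ A.Isolated Q (𝒞.sup id) (r + 1) := by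
  obtain ⟨Q, hQ, hrun, hports⟩ := exists_wiring_sup hdisj hn (Nat.le_succ r) hP hiso
    fun C hC x hx => (card_usedPorts_le (r + 1) hx).trans_lt (hsent C hC)
  refine ⟨Q, hQ, fun s hs x hx i hi => ?_⟩
  obtain ⟨C, hC, hxC⟩ := Finset.mem_sup.1 hx
  rw [id] at hxC
  rw [hrun s hs C hC x hxC] at hi
  refine hports C hC x hxC i (Finset.mem_union_left _ ?_)
  simpa using ⟨s, hs, hi⟩

/-- Clusters that are isolated through round `r` fit together into an execution on their union. -/
theorem exists_run_sup {𝒞 : Finset (Finset ℤ)} {P : Finset ℤ → ℤ → ℤ → Fin (n - 1)} {r : ℕ}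
    (hdisj : (𝒞 : Set (Finset ℤ)).PairwiseDisjoint id) (hn : (𝒞.sup id).card ≤ n)
    (hP : ∀ C ∈ 𝒞, IsWiring (P C) C) (hiso : ∀ C ∈ 𝒞, A.Isolated (P C) C r) :
    ∃ Q : ℤ → ℤ → Fin (n - 1), IsWiring Q (𝒞.sup id) ∧
      ∀ s ≤ r + 1, ∀ C ∈ 𝒞, ∀ x ∈ C, A.run Q (𝒞.sup id) s x = A.run (P C) C s x := by
  classical
  -- For `R = r` no message bound is needed: by isolation the used ports of `x` lead to the other
  -- nodes of `C`, of which there are fewer than `S.card`.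
  obtain ⟨Q, hQ, hrun, -⟩ := exists_wiring_sup hdisj hn le_rfl hP hiso fun C hC x hx => by
    refine lt_of_le_of_lt (Finset.card_le_card (t := (C.erase x).image (P C x)) ?_)
      (Finset.card_image_le.trans_lt ((Finset.card_erase_lt_of_mem hx).trans_le
        (Finset.card_le_card (Finset.le_sup (f := id) hC))))
    intro i hi
    rcases Finset.mem_union.1 hi with hi | hi
    · obtain ⟨s, hs, h⟩ := (Finset.mem_filter.1 hi).2
      obtain ⟨y, hy, hyx, rfl⟩ := hiso C hC s hs x hx i h
      exact Finset.mem_image_of_mem _ (Finset.mem_erase.2 ⟨hyx, hy⟩)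
    · exact Finset.image_subset_image (Finset.filter_subset _ _) hi
  exact ⟨Q, hQ, hrun⟩

end Algorithm
-- From wirings to port mappings of the clique
/-- A wiring of `n` nodes comes from a port mapping. -/
theorem exists_portMapping {Q : ℤ → ℤ → Fin (n - 1)} {S : Finset ℤ} (hQ : IsWiring Q S)
    {ids : Fin n → ℤ} (hids : Function.Injective ids) (hS : ∀ w, ids w ∈ S) :
    ∃ p : PortMapping n, ∀ w v, v ≠ w →
      p.link (w, Q (ids w) (ids v)) = (v, Q (ids v) (ids w)) := by
  have hinj : ∀ w v v', v ≠ w → v' ≠ w → Q (ids w) (ids v) = Q (ids w) (ids v') → v = v' := by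
    intro w v v' hv hv' h
    refine hids (hQ _ (hS w) ?_ ?_ h)
    · simpa using ⟨hS v, hids.ne hv⟩
    · simpa using ⟨hS v', hids.ne hv'⟩
  have hsurj : ∀ w i, ∃ v, v ≠ w ∧ Q (ids w) (ids v) = i := by
    intro w i
    -- Counting: `n - 1` other nodes occupy different ports among `n - 1`, so no port is dead.
    have : ((Finset.univ.erase w).image fun v => Q (ids w) (ids v)) = Finset.univ := by
      rw [← Finset.card_eq_iff_eq_univ, Finset.card_image_of_injOn, Finset.card_erase_of_mem
        (Finset.mem_univ w), Finset.card_univ, Fintype.card_fin, Fintype.card_fin]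
      intro v hv v' hv' h
      exact hinj w v v' (by simpa using hv) (by simpa using hv') h
    have hi := Finset.mem_univ i
    rw [← this, Finset.mem_image] at hi
    obtain ⟨v, hv, rfl⟩ := hi
    exact ⟨v, by simpa using hv, rfl⟩
  choose dest hne hdest using hsurj
  have hd : ∀ w v, v ≠ w → dest w (Q (ids w) (ids v)) = v := fun w v hv =>
    hinj w _ _ (hne _ _) hv (hdest _ _)
  refine ⟨⟨fun x => (dest x.1 x.2, Q (ids (dest x.1 x.2)) (ids x.1)), ?_, ?_, ?_⟩, ?_⟩
  · rintro ⟨w, i⟩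
    have h : dest (dest w i) (Q (ids (dest w i)) (ids w)) = w := hd _ _ (hne w i).symm
    simp only [h, hdest]
  · exact hne
  · intro w i j h
    rw [← hdest w i, ← hdest w j]
    exact congrArg (fun v => Q (ids w) (ids v)) h
  · intro w v hv
    simp only [hd w v hv]

namespace Algorithm

variable {A : Algorithm.{u, v} n} {Q : ℤ → ℤ → Fin (n - 1)} {S : Finset ℤ}

/-- Port `i` of `w` leads to some `v ≠ w`, and distinctness of destinations forces `i = Q (ids w)
(ids v)`; so both executions deliver the same inbox. -/
theorem config_eq_run (hQ : IsWiring Q S) {ids : Fin n → ℤ} (hids : Function.Injective ids)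
    (hS : ∀ w, ids w ∈ S) {p : PortMapping n}
    (hp : ∀ w v, v ≠ w → p.link (w, Q (ids w) (ids v)) = (v, Q (ids v) (ids w))) (r : ℕ)
    (w : Fin n) : A.config ids p r w = A.run Q S r (ids w) := by
  classical
  induction r generalizing w with
  | zero => rfl
  | succ r ih =>
    simp only [config, run, ih]
    congr 2
    funext i
    have hv : (p.link (w, i)).1 ≠ w := p.ne_self w i
    set v := (p.link (w, i)).1 with hvdef
    have h1 := hp w v hv
    have hi : Q (ids w) (ids v) = i := by
      apply p.injective_dest w
      simp only [h1, ← hvdef]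
    rw [hi] at h1
    rw [← hi, inbox_of_mem (fun z => (A.run Q S r z).2) hQ (hS w) (hS v) (hids.ne hv), hi, h1]

theorem exists_execution {U : Set ℤ} (A : Algorithm.{u, v} n) (hQ : IsWiring Q S)
    (hSU : (S : Set ℤ) ⊆ U) (hn : S.card = n) :
    ∃ (ids : Fin n → ℤ) (p : PortMapping n), ValidIDs U ids ∧ (∀ w, ids w ∈ S) ∧
      (∀ x ∈ S, ∃ w, ids w = x) ∧ (∀ r w, A.config ids p r w = A.run Q S r (ids w)) ∧
      ∀ R, A.messages ids p R = ∑ x ∈ S, A.sentBy Q S R x := by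
  classical
  let e : S ≃ Fin n := S.equivFinOfCardEq hn
  let ids : Fin n → ℤ := fun w => e.symm w
  have hids : Function.Injective ids := Subtype.val_injective.comp e.symm.injective
  have hS : ∀ w, ids w ∈ S := fun w => (e.symm w).2
  have hS' : ∀ x ∈ S, ∃ w, ids w = x := fun x hx => ⟨e ⟨x, hx⟩, by simp [ids]⟩
  obtain ⟨p, hp⟩ := exists_portMapping hQ hids hS
  have hrun := fun r w => config_eq_run (A := A) hQ hids hS hp r w
  refine ⟨ids, p, ⟨hids, fun w => hSU (hS w)⟩, hS, hS', hrun, fun R => ?_⟩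
  have hin : ∀ r, A.messagesIn ids p r = ∑ x ∈ S, A.sentIn Q S r x := by
    intro r
    rw [messagesIn, Finset.card_filter, Fintype.sum_prod_type, ← Finset.sum_coe_sort S,
      ← e.symm.sum_comp]
    refine Finset.sum_congr rfl fun w _ => ?_
    rw [sentIn, Finset.card_filter]
    simp only [hrun]
    rfl
  simp only [messages, hin, sentBy]
  exact Finset.sum_comm

end Algorithm

/-! ### Pools of isolated clusters -/

/-- `𝒞` consists of disjoint sets of IDs from `U` of size `σ`, each of which can be wired so that it
is isolated through round `r`. -/
structure IsPool (A : Algorithm.{u, v} n) (U : Set ℤ) (σ r : ℕ) (𝒞 : Finset (Finset ℤ)) : Prop where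
  disj : (𝒞 : Set (Finset ℤ)).PairwiseDisjoint id
  subset : ∀ C ∈ 𝒞, (C : Set ℤ) ⊆ U
  card : ∀ C ∈ 𝒞, C.card = σ
  wiring : ∀ C ∈ 𝒞, ∃ P, IsWiring P C ∧ A.Isolated P C r

namespace IsPool

variable {A : Algorithm.{u, v} n} {U : Set ℤ} {σ r : ℕ} {𝒞 ℬ : Finset (Finset ℤ)}

theorem mono (h : IsPool A U σ r 𝒞) (hℬ : ℬ ⊆ 𝒞) : IsPool A U σ r ℬ where
  disj := h.disj.subset (Finset.coe_subset.2 hℬ)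
  subset C hC := h.subset C (hℬ hC)
  card C hC := h.card C (hℬ hC)
  wiring C hC := h.wiring C (hℬ hC)

theorem sum_sup (h : IsPool A U σ r 𝒞) (f : ℤ → ℕ) :
    ∑ x ∈ 𝒞.sup id, f x = ∑ C ∈ 𝒞, ∑ x ∈ C, f x := by
  classical
  rw [Finset.sup_eq_biUnion, Finset.sum_biUnion h.disj]
  rfl

theorem card_sup (h : IsPool A U σ r 𝒞) : (𝒞.sup id).card = 𝒞.card * σ := by
  classical
  rw [Finset.card_eq_sum_ones, h.sum_sup, Finset.sum_congr rfl
    (g := fun _ => σ) (fun C hC => by simpa using h.card C hC)]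
  simp

theorem sup_subset (h : IsPool A U σ r 𝒞) : ((𝒞.sup id : Finset ℤ) : Set ℤ) ⊆ U := by
  intro x hx
  obtain ⟨C, hC, hxC⟩ := Finset.mem_sup.1 (Finset.mem_coe.1 hx)
  exact h.subset C hC hxC

/-- As many clusters of a pool as make `n` nodes fit together into an execution of the clique. -/
theorem exists_execution (h : IsPool A U σ r 𝒞) (hn : 𝒞.card * σ = n)
    {P : Finset ℤ → ℤ → ℤ → Fin (n - 1)}
    (hP : ∀ C ∈ 𝒞, IsWiring (P C) C ∧ A.Isolated (P C) C r) :
    ∃ (ids : Fin n → ℤ) (p : PortMapping n), ValidIDs U ids ∧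
      (∀ w, ∃ C ∈ 𝒞, ids w ∈ C) ∧ (∀ C ∈ 𝒞, ∀ x ∈ C, ∃ w, ids w = x) ∧
      (∀ s ≤ r + 1, ∀ C ∈ 𝒞, ∀ w, ids w ∈ C → A.config ids p s w = A.run (P C) C s (ids w)) ∧
      A.messages ids p (r + 1) = ∑ C ∈ 𝒞, ∑ x ∈ C, A.sentBy (P C) C (r + 1) x := by
  have hcard : (𝒞.sup id).card = n := h.card_sup.trans hn
  obtain ⟨Q, hQ, hrun⟩ := Algorithm.exists_run_sup h.disj hcard.le
    (fun C hC => (hP C hC).1) (fun C hC => (hP C hC).2)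
  obtain ⟨ids, p, hval, hS, hS', hconf, hmes⟩ := A.exists_execution hQ h.sup_subset hcard
  refine ⟨ids, p, hval, fun w => by simpa [Finset.mem_sup] using hS w,
    fun C hC x hx => hS' x (Finset.mem_sup.2 ⟨C, hC, hx⟩), fun s hs C hC w hw => ?_, ?_⟩
  · rw [hconf, hrun s hs C hC _ hw]
  · rw [hmes, h.sum_sup]
    refine Finset.sum_congr rfl fun C hC => Finset.sum_congr rfl fun x hx => ?_
    refine Finset.sum_congr rfl fun s hs => ?_
    rw [Algorithm.sentIn, Algorithm.sentIn, hrun s (Finset.mem_Icc.1 hs).2 C hC x hx]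

/-- If a leader is elected, no pool of isolated clusters exceeds a partition of the clique into at
least two clusters. -/
theorem card_le (h : IsPool A U σ r 𝒞) {m T : ℕ} (hm : 2 ≤ m) (hn : m * σ = n) (hT : T ≤ r + 1)
    (hA : A.ElectsLeaderIn U T) : 𝒞.card ≤ m := by
  classical
  by_contra! hlt
  obtain ⟨𝒟, h𝒟, hcard⟩ := Finset.exists_subset_card_eq (Nat.succ_le_of_lt hlt)
  replace h := h.mono h𝒟
  clear h𝒟 hlt
  have hw := h.wiring
  have : Nonempty (ℤ → ℤ → Fin (n - 1)) := by
    obtain ⟨C, hC⟩ := Finset.card_pos.1 (by omega : 0 < 𝒟.card)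
    exact (hw C hC).nonempty
  choose! P hP using hw
  -- The number of leaders that a cluster produces when it runs alone.
  set ℓ : Finset ℤ → ℕ := fun C =>
    (C.filter fun x => A.output (A.run (P C) C T x).1 = some true).card with hℓ
  -- Leaving out any one of the `m + 1` clusters gives a full clique, which elects exactly one
  -- leader.
  have key : ∀ C ∈ 𝒟, ∑ D ∈ 𝒟.erase C, ℓ D = 1 := by
    intro C hC
    have h' := h.mono (Finset.erase_subset C 𝒟)
    have hc : (𝒟.erase C).card = m := by rw [Finset.card_erase_of_mem hC]; omega
    obtain ⟨ids, p, hval, hS, hS', hconf, -⟩ := h'.exists_execution (by rw [hc, hn])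
      (fun D hD => hP D (Finset.mem_of_mem_erase hD))
    obtain ⟨w, hw, huniq⟩ := (hA ids p hval).2
    obtain ⟨D, hD, hwD⟩ := hS w
    have hout : ∀ E ∈ 𝒟.erase C, ∀ v, ids v ∈ E →
        A.outputBy ids p T v = A.output (A.run (P E) E T (ids v)).1 := fun E hE v hv => by
      rw [Algorithm.outputBy, hconf T hT E hE v hv]
    rw [Finset.sum_eq_single_of_mem D hD]
    · rw [hℓ, Finset.card_eq_one]
      refine ⟨ids w, Finset.eq_singleton_iff_unique_mem.2 ⟨?_, ?_⟩⟩
      · exact Finset.mem_filter.2 ⟨hwD, by rw [← hout D hD w hwD]; exact hw⟩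
      · intro x hx
        obtain ⟨hxD, hx⟩ := Finset.mem_filter.1 hx
        obtain ⟨v, rfl⟩ := hS' D hD x hxD
        rw [huniq v ((hout D hD v hxD).trans hx)]
    · intro E hE hED
      rw [hℓ, Finset.card_eq_zero, Finset.filter_eq_empty_iff]
      intro x hxE hx
      obtain ⟨v, rfl⟩ := hS' E hE x hxE
      rw [huniq v ((hout E hE v hxE).trans hx)] at hxE
      exact hED (h'.disj.elim_finset hE hD _ hxE hwD)
  have hsum : ∀ C ∈ 𝒟, ℓ C + 1 = ∑ D ∈ 𝒟, ℓ D := fun C hC => by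
    rw [← key C hC, Finset.add_sum_erase _ _ hC]
  have htot : ∑ C ∈ 𝒟, (ℓ C + 1) = ∑ C ∈ 𝒟, ∑ D ∈ 𝒟, ℓ D := Finset.sum_congr rfl hsum
  rw [Finset.sum_add_distrib, Finset.sum_const, Finset.sum_const, hcard] at htot
  simp only [smul_eq_mul, mul_one] at htot
  -- With `L` the sum of all `ℓ D`, summing `ℓ C + 1 = L` over the `m + 1` clusters gives `L + (m +
  -- 1) = (m + 1) * L`. Hence `m` divides `1`.
  have h1 : (m + 1) = m * ∑ D ∈ 𝒟, ℓ D := by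
    have : m.succ = m + 1 := rfl
    rw [this] at htot
    nlinarith
  have hdvd : m ∣ m + 1 := ⟨_, h1⟩
  have := (Nat.dvd_add_right (dvd_refl m)).1 hdvd
  have := Nat.le_of_dvd one_pos this
  omega

end IsPool
-- Growing the clusters by one round
/-- Disjoint nonempty sets can be grouped into unions of `b` sets each. -/
theorem exists_grouping {α : Type*} [DecidableEq α] {b : ℕ} (hb : 0 < b) (q : ℕ)
    (𝒢 : Finset (Finset α)) (hdisj : (𝒢 : Set (Finset α)).PairwiseDisjoint id)
    (hne : ∀ C ∈ 𝒢, C.Nonempty) (hq : q * b ≤ 𝒢.card) :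
    ∃ 𝒟 : Finset (Finset α), 𝒟.card = q ∧ (𝒟 : Set (Finset α)).PairwiseDisjoint id ∧
      ∀ D ∈ 𝒟, ∃ ℋ ⊆ 𝒢, ℋ.card = b ∧ D = ℋ.sup id := by
  induction q generalizing 𝒢 with
  | zero => exact ⟨∅, by simp⟩
  | succ q ih =>
    obtain ⟨ℋ, hℋ, hcard⟩ := Finset.exists_subset_card_eq (s := 𝒢) (n := b) (by nlinarith)
    have hsub : 𝒢 \ ℋ ⊆ 𝒢 := Finset.sdiff_subset
    obtain ⟨𝒟, h1, h2, h3⟩ := ih (𝒢 \ ℋ) (hdisj.subset (Finset.coe_subset.2 hsub))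
      (fun C hC => hne C (hsub hC)) (by
        rw [Finset.card_sdiff_of_subset hℋ, hcard]
        have : (q + 1) * b = q * b + b := by ring
        omega)
    have hd : ∀ D ∈ 𝒟, Disjoint (ℋ.sup id) D := by
      intro D hD
      obtain ⟨ℋ', hℋ', -, rfl⟩ := h3 D hD
      rw [Finset.disjoint_sup_left]
      intro C hC
      rw [Finset.disjoint_sup_right]
      intro C' hC'
      have hC'' := Finset.mem_sdiff.1 (hℋ' hC')
      exact hdisj (hℋ hC) hC''.1 fun h => hC''.2 (h ▸ hC)
    -- Nonemptiness enters here: empty unions could coincide and spoil the count.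
    have hnot : ℋ.sup id ∉ 𝒟 := by
      intro h
      obtain ⟨C, hC⟩ := Finset.card_pos.1 (hcard ▸ hb)
      obtain ⟨x, hx⟩ := hne C (hℋ hC)
      have hx' : x ∈ ℋ.sup id := Finset.mem_sup.2 ⟨C, hC, hx⟩
      exact Finset.disjoint_left.1 (hd _ h) hx' hx'
    refine ⟨insert (ℋ.sup id) 𝒟, by rw [Finset.card_insert_of_notMem hnot, h1], ?_, ?_⟩
    · rw [Finset.coe_insert]
      exact h2.insert fun D hD _ => hd D hD
    · intro D hD
      rcases Finset.mem_insert.1 hD with rfl | hD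
      · exact ⟨ℋ, hℋ, hcard, rfl⟩
      · obtain ⟨ℋ', h, h'⟩ := h3 D hD
        exact ⟨ℋ', h.trans hsub, h'⟩

namespace IsPool

variable {A : Algorithm.{u, v} n} {U : Set ℤ} {σ r : ℕ} {𝒞 ℬ : Finset (Finset ℤ)}

/-- Clusters of size `σ` that send more than `σ * f` messages by round `r + 1` do not fill the
clique, if at most `n * f` messages are sent in every execution. -/
theorem card_mul_lt (h : IsPool A U σ r 𝒞) {P : Finset ℤ → ℤ → ℤ → Fin (n - 1)} {f : ℝ} {T : ℕ}
    (hn : 0 < n) (hσ : σ ∣ n) (hT : r + 1 ≤ T)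
    (hP : ∀ C ∈ 𝒞, IsWiring (P C) C ∧ A.Isolated (P C) C r)
    (hmes : ∀ (ids : Fin n → ℤ) (p : PortMapping n),
      ValidIDs U ids → (A.messages ids p T : ℝ) ≤ n * f)
    (hbad : ∀ C ∈ 𝒞, (σ : ℝ) * f < (∑ x ∈ C, A.sentBy (P C) C (r + 1) x : ℕ)) :
    𝒞.card * σ < n := by
  by_contra! hle
  obtain ⟨m, rfl⟩ := hσ
  have hσ : 0 < σ := Nat.pos_of_mul_pos_right hn
  have hm : 0 < m := Nat.pos_of_mul_pos_left hn
  obtain ⟨ℬ, hℬ, hcard⟩ := Finset.exists_subset_card_eq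
    (show m ≤ 𝒞.card from Nat.le_of_mul_le_mul_left (by linarith) hσ)
  obtain ⟨ids, p, hval, -, -, -, hms⟩ := (h.mono hℬ).exists_execution
    (by rw [hcard, mul_comm]) fun C hC => hP C (hℬ hC)
  have h1 : A.messages ids p (r + 1) ≤ A.messages ids p T :=
    Finset.sum_le_sum_of_subset (Finset.Icc_subset_Icc_right hT)
  have h2 := hmes ids p hval
  have h3 : ∑ C ∈ ℬ, (σ : ℝ) * f <
      ∑ C ∈ ℬ, ((∑ x ∈ C, A.sentBy (P C) C (r + 1) x : ℕ) : ℝ) :=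
    Finset.sum_lt_sum_of_nonempty (Finset.card_pos.1 (hcard ▸ hm)) fun C hC => hbad C (hℬ hC)
  rw [Finset.sum_const, hcard, nsmul_eq_mul, ← Nat.cast_sum, ← hms] at h3
  have h4 : (A.messages ids p (r + 1) : ℝ) ≤ A.messages ids p T := by exact_mod_cast h1
  push_cast at h2
  nlinarith

/-- One more round: the clusters of size `σ` yield clusters of size `b * σ`, and less than `2 * n`
IDs are lost. -/
theorem exists_succ (h : IsPool A U σ r 𝒞) {f : ℝ} {b T : ℕ} (hσ : 0 < σ) (hσn : σ ∣ n)
    (hb : f < b) (hb0 : 0 < b) (hbn : b * σ ≤ n) (hT : r + 1 ≤ T)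
    (hmes : ∀ (ids : Fin n → ℤ) (p : PortMapping n),
      ValidIDs U ids → (A.messages ids p T : ℝ) ≤ n * f) :
    ∃ 𝒟, IsPool A U (b * σ) (r + 1) 𝒟 ∧ 𝒞.card * σ ≤ 𝒟.card * (b * σ) + 2 * n := by
  classical
  have hn : 0 < n := by nlinarith
  rcases 𝒞.eq_empty_or_nonempty with rfl | ⟨C₀, hC₀⟩
  · exact ⟨∅, ⟨by simp, by simp, by simp, by simp⟩, by simp⟩
  have hw := h.wiring
  have : Nonempty (ℤ → ℤ → Fin (n - 1)) := (hw C₀ hC₀).nonempty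
  choose! P hP using hw
  let bad : Finset ℤ → Prop := fun C =>
    (σ : ℝ) * f < (∑ x ∈ C, A.sentBy (P C) C (r + 1) x : ℕ)
  have hbad : (𝒞.filter bad).card * σ < n :=
    (h.mono (Finset.filter_subset bad 𝒞)).card_mul_lt hn hσn hT
      (fun C hC => hP C (Finset.mem_filter.1 hC).1) hmes fun C hC => (Finset.mem_filter.1 hC).2
  set 𝒢 := 𝒞.filter fun C => ¬ bad C with h𝒢def
  have h𝒢 : 𝒢 ⊆ 𝒞 := Finset.filter_subset _ _
  have hsplit : (𝒞.filter bad).card + 𝒢.card = 𝒞.card := Finset.card_filter_add_card_filter_not _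
  have hpool := h.mono h𝒢
  obtain ⟨𝒟, hcard, hdisj, h𝒟⟩ := exists_grouping hb0 (𝒢.card / b) 𝒢 hpool.disj
    (fun C hC => Finset.card_pos.1 (hpool.card C hC ▸ hσ)) (Nat.div_mul_le_self _ _)
  refine ⟨𝒟, ⟨hdisj, ?_, ?_, ?_⟩, ?_⟩
  · intro D hD
    obtain ⟨ℋ, hℋ, hc, rfl⟩ := h𝒟 D hD
    exact (hpool.mono hℋ).sup_subset
  · intro D hD
    obtain ⟨ℋ, hℋ, hc, rfl⟩ := h𝒟 D hD
    rw [(hpool.mono hℋ).card_sup, hc]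
  · intro D hD
    obtain ⟨ℋ, hℋ, hc, rfl⟩ := h𝒟 D hD
    have hcs : (ℋ.sup id).card = b * σ := by rw [(hpool.mono hℋ).card_sup, hc]
    refine Algorithm.exists_isolated_sup (hpool.mono hℋ).disj (hcs.trans_le hbn)
      (fun C hC => (hP C (h𝒢 (hℋ hC))).1) (fun C hC => (hP C (h𝒢 (hℋ hC))).2) fun C hC => ?_
    have hgood := not_lt.1 (Finset.mem_filter.1 (hℋ hC)).2
    rw [hcs]
    have hσ' : (0 : ℝ) < σ := by exact_mod_cast hσ
    have : ((∑ x ∈ C, A.sentBy (P C) C (r + 1) x : ℕ) : ℝ) < (b * σ : ℕ) := by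
      push_cast at hgood ⊢
      nlinarith
    exact_mod_cast this
  · have hmod := Nat.div_add_mod 𝒢.card b
    have hlt := Nat.mod_lt 𝒢.card hb0
    rw [hcard, ← hsplit, add_mul]
    -- Fewer than `b` clusters stay ungrouped, which costs at most `b * σ ≤ n` IDs; the bad clusters
    -- cost fewer than `n` more.
    have : 𝒢.card * σ ≤ 𝒢.card / b * (b * σ) + b * σ := by
      nlinarith
    omega

end IsPool

/-! ### Iterating over the rounds -/

namespace Algorithm

variable {A : Algorithm.{u, v} n} {U : Set ℤ}

theorem isWiring_singleton (P : ℤ → ℤ → Fin (n - 1)) (x : ℤ) : IsWiring P {x} := by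
  intro y hy
  simp [Finset.mem_singleton.1 hy]

/-- The pool of all singletons of a set of IDs. -/
theorem isPool_singletons (X : Finset ℤ) (hX : (X : Set ℤ) ⊆ U) (P : ℤ → ℤ → Fin (n - 1)) (r : ℕ)
    (hP : ∀ x ∈ X, A.Isolated P {x} r) :
    IsPool A U 1 r (X.map ⟨singleton, Finset.singleton_injective⟩) where
  disj := by
    intro C hC D hD hCD
    simp only [Finset.coe_map, Function.Embedding.coeFn_mk, Set.mem_image] at hC hD
    obtain ⟨x, -, rfl⟩ := hC
    obtain ⟨y, -, rfl⟩ := hD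
    have hxy : x ≠ y := fun h => hCD (by rw [h])
    simpa [Function.onFun] using hxy
  subset C hC := by
    obtain ⟨x, hx, rfl⟩ := Finset.mem_map.1 hC
    simpa using hX hx
  card C hC := by
    obtain ⟨x, hx, rfl⟩ := Finset.mem_map.1 hC
    simp
  wiring C hC := by
    obtain ⟨x, hx, rfl⟩ := Finset.mem_map.1 hC
    exact ⟨P, isWiring_singleton P x, hP x hx⟩

theorem isolated_zero (P : ℤ → ℤ → Fin (n - 1)) (C : Finset ℤ) : A.Isolated P C 0 := by
  intro s hs x _ i hi
  obtain rfl : s = 0 := by omega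
  simp [run] at hi

/-- The term `2 * n * r` is the loss of `r` applications of `exists_succ` to the singletons of `X`.
-/
theorem exists_pool_pow {f : ℝ} {b T : ℕ} (hn : 2 ≤ n) {X : Finset ℤ} (hX : (X : Set ℤ) ⊆ U)
    (hb : f < b) (hb0 : 0 < b) (hmes : ∀ (ids : Fin n → ℤ) (p : PortMapping n),
      ValidIDs U ids → (A.messages ids p T : ℝ) ≤ n * f) (r : ℕ) (hr : r ≤ T) (hbr : b ^ r ∣ n) :
    ∃ 𝒞, IsPool A U (b ^ r) r 𝒞 ∧ X.card ≤ 𝒞.card * b ^ r + 2 * n * r := by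
  induction r with
  | zero =>
    refine ⟨_, isPool_singletons X hX (fun _ _ => ⟨0, by omega⟩) 0
      fun x _ => isolated_zero _ _, by simp⟩
  | succ r ih =>
    have hdvd : b ^ r ∣ n := (pow_dvd_pow b (Nat.le_succ r)).trans hbr
    obtain ⟨𝒞, h𝒞, hcard⟩ := ih (by omega) hdvd
    have hle := Nat.le_of_dvd (by omega) hbr
    rw [pow_succ'] at hle ⊢
    obtain ⟨𝒟, h𝒟, hcard'⟩ := h𝒞.exists_succ (pow_pos hb0 r) hdvd hb hb0 hle hr hmes
    exact ⟨𝒟, h𝒟, by rw [mul_add]; omega⟩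

/-- Otherwise clusters of size `(2 ^ j) ^ (T - 1)` split the clique into at least two parts, so
`card_le` lets them cover at most `n` IDs. But fewer than `2 * n * m` IDs were lost on the way, so
more than `n` remain. -/
theorem two_pow_lt_of_electsLeaderIn {f : ℝ} {m j T : ℕ} {X : Finset ℤ} (hm : 1 ≤ m)
    (hnm : n = 2 ^ m) (hX : (X : Set ℤ) ⊆ U) (hcard : 2 * n * m + n ≤ X.card)
    (hf : f < (2 ^ j : ℕ)) (hj : 1 ≤ j)
    (hA : A.ElectsLeaderIn U T) (hmes : ∀ (ids : Fin n → ℤ) (p : PortMapping n),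
      ValidIDs U ids → (A.messages ids p T : ℝ) ≤ n * f) : m - 1 < j * (T - 1) := by
  by_contra! hle
  have hn : 2 ≤ n := by
    rw [hnm]; exact Nat.le_self_pow (by omega) 2
  have hpow : (2 ^ j) ^ (T - 1) * 2 ^ (m - j * (T - 1)) = n := by
    rw [← pow_mul, ← pow_add, hnm]; congr 1; omega
  obtain ⟨𝒞, h𝒞, hc⟩ := exists_pool_pow hn hX hf (by positivity) hmes (T - 1) (by omega)
    ⟨_, hpow.symm⟩
  have h2 : 2 ≤ 2 ^ (m - j * (T - 1)) := Nat.le_self_pow (by omega) 2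
  have hlast := h𝒞.card_le h2 (by rw [mul_comm]; exact hpow) (by omega) hA
  have hmul : 𝒞.card * (2 ^ j) ^ (T - 1) ≤ n := by
    calc _ ≤ 2 ^ (m - j * (T - 1)) * (2 ^ j) ^ (T - 1) := Nat.mul_le_mul_right _ hlast
      _ = n := by rw [mul_comm]; exact hpow
  have hT : T - 1 + 1 ≤ m := by
    have := Nat.le_mul_of_pos_left (T - 1) hj
    omega
  have : 2 * n * (T - 1 + 1) ≤ 2 * n * m := Nat.mul_le_mul_left _ hT
  rw [mul_add] at this
  omega

end Algorithm
-- The linear bound and the tradeoff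
namespace Algorithm

variable {A : Algorithm.{u, v} n} {U : Set ℤ} {Q : ℤ → ℤ → Fin (n - 1)} {S : Finset ℤ}

/-- A node that no message leaves or reaches runs as it does alone. -/
theorem run_singleton_eq (hQ : IsWiring Q S) {x : ℤ} (hx : x ∈ S) {T : ℕ}
    (P : ℤ → ℤ → Fin (n - 1)) (hin : ∀ y ∈ S, y ≠ x → ¬ A.Crosses Q S T y x) :
    ∀ s ≤ T, A.run Q S s x = A.run P {x} s x := by
  intro s
  induction s with
  | zero => intro; rfl
  | succ s ih =>
    intro hs
    refine run_succ_congr (isWiring_singleton P x) hQ (Finset.mem_singleton_self x) hx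
      (by rw [ih (by omega)]) ?_ ?_
    · exact fun y hy hyx => absurd (Finset.mem_singleton.1 hy) hyx
    · exact fun y hy hyx h => absurd ⟨s, by omega, h⟩ (hin y hy hyx)

-- Double counting: the nodes reached from `y` lie behind different ports of `y`, each of which has
-- carried a message of `y`.
open Classical in
theorem sum_card_crosses_le (hQ : IsWiring Q S) (T : ℕ) :
    ∑ x ∈ S, ((S.erase x).filter fun y => A.Crosses Q S T y x).card ≤
      ∑ x ∈ S, A.sentBy Q S T x := by
  have hcomm : ∑ x ∈ S, ((S.erase x).filter fun y => A.Crosses Q S T y x).card =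
      ∑ y ∈ S, ((S.erase y).filter fun x => A.Crosses Q S T y x).card := by
    simp only [Finset.card_filter]
    refine Finset.sum_comm' fun x y => ?_
    simp only [Finset.mem_erase, ne_comm (a := x)]
    tauto
  rw [hcomm]
  refine Finset.sum_le_sum fun y hy => le_trans ?_ (card_ports_le_sentBy T y)
  refine Finset.card_le_card_of_injOn (Q y) (fun x hx => ?_)
    ((hQ y hy).mono (Finset.coe_subset.2 (Finset.filter_subset _ _)))
  simpa [Crosses] using (Finset.mem_filter.1 hx).2

/-- Some execution of a leader election sends at least `n / 2` messages. -/
theorem exists_linear_messages {T : ℕ} (hn : 2 ≤ n) {X : Finset ℤ} (hX : (X : Set ℤ) ⊆ U)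
    (hcard : 2 * n ≤ X.card) (hA : A.ElectsLeaderIn U T) :
    ∃ (ids : Fin n → ℤ) (p : PortMapping n), ValidIDs U ids ∧ n ≤ 2 * A.messages ids p T := by
  classical
  let P : ℤ → ℤ → Fin (n - 1) := fun _ _ => ⟨0, by omega⟩
  have hsplit := Finset.card_filter_add_card_filter_not (s := X) fun x => A.Isolated P {x} T
  -- An isolated singleton is an ID that stays silent when it hears nothing. By `card_le` with
  -- clusters of size `1`, at most `n` IDs are of this kind.
  have hquiet : (X.filter fun x => A.Isolated P {x} T).card ≤ n := by
    have hpool := isPool_singletons (U := U) (X.filter fun x => A.Isolated P {x} T)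
      (fun x hx => hX (Finset.mem_filter.1 hx).1) P T fun x hx => (Finset.mem_filter.1 hx).2
    simpa using hpool.card_le hn (mul_one n) (Nat.le_succ T) hA
  obtain ⟨S, hS, hSn⟩ := Finset.exists_subset_card_eq
    (show n ≤ (X.filter fun x => ¬ A.Isolated P {x} T).card by omega)
  have hSX : (S : Set ℤ) ⊆ U := fun x hx => hX (Finset.mem_filter.1 (hS hx)).1
  have hpool := isPool_singletons (A := A) S hSX P 0 fun x _ => isolated_zero _ _
  have hsup : (S.map ⟨singleton, Finset.singleton_injective⟩).sup id = S := by
    rw [Finset.sup_map]; exact Finset.sup_singleton_eq_self S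
  -- Any wiring of `S` will do.
  obtain ⟨Q, hQ, -⟩ := exists_run_sup (P := fun _ => P) (r := 0) hpool.disj
    (by rw [hsup, hSn]) (A := A) (fun C hC => by
      obtain ⟨x, -, rfl⟩ := Finset.mem_map.1 hC
      exact isWiring_singleton P x) fun C _ => isolated_zero _ _
  rw [hsup] at hQ
  obtain ⟨ids, p, hval, -, -, -, hmes⟩ := A.exists_execution hQ hSX hSn
  refine ⟨ids, p, hval, ?_⟩
  -- A node of `S` that receives nothing runs as it does alone, and then it sends a message because
  -- it is not quiet. So every node sends or receives.
  have htouch : ∀ x ∈ S, 1 ≤ A.sentBy Q S T x +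
      ((S.erase x).filter fun y => A.Crosses Q S T y x).card := by
    intro x hx
    by_contra! h0
    have hin : ∀ y ∈ S, y ≠ x → ¬ A.Crosses Q S T y x := fun y hy hyx h => by
      have : 0 < ((S.erase x).filter fun y => A.Crosses Q S T y x).card :=
        Finset.card_pos.2 ⟨y, by simp [hy, hyx, h]⟩
      omega
    refine (Finset.mem_filter.1 (hS hx)).2 fun s hs y hy i hi => ?_
    rw [Finset.mem_singleton.1 hy, ← run_singleton_eq hQ hx P hin s hs] at hi
    have := one_le_sentBy hs hi
    omega
  have h1 := Finset.sum_le_sum htouch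
  have h2 := sum_card_crosses_le (A := A) hQ T
  rw [Finset.sum_add_distrib, Finset.sum_const, smul_eq_mul, mul_one, hSn] at h1
  rw [hmes]
  omega

/-- The tradeoff between the number of rounds and the number of messages. -/
theorem rounds_gt {f : ℝ} {m T : ℕ} {X : Finset ℤ} (hm : 1 ≤ m)
    (hnm : n = 2 ^ m) (hX : (X : Set ℤ) ⊆ U) (hcard : 2 * n * m + n ≤ X.card)
    (hf : 1 < f) (hA : A.ElectsLeaderIn U T) (hmes : ∀ (ids : Fin n → ℤ) (p : PortMapping n),
      ValidIDs U ids → (A.messages ids p T : ℝ) ≤ n * f) :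
    (T : ℝ) > (Real.logb 2 n - 1) / (Real.logb 2 f + 1) + 1 := by
  -- The merging factor is `2 ^ (j + 1)`, where `2 ^ j ≤ f < 2 ^ (j + 1)`; rounding up to a power of
  -- two causes the `+ 1` in the denominator.
  obtain ⟨j, hj1, hj2⟩ := exists_nat_pow_near hf.le one_lt_two
  have key := two_pow_lt_of_electsLeaderIn (j := j + 1) hm hnm hX hcard (by exact_mod_cast hj2)
    (by omega) hA hmes
  have hlog : (j : ℝ) ≤ Real.logb 2 f := by
    rw [Real.le_logb_iff_rpow_le one_lt_two (by linarith), Real.rpow_natCast]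
    exact hj1
  have hlogn : Real.logb 2 n = m := by
    rw [hnm]; push_cast
    rw [Real.logb_pow, Real.logb_self_eq_one one_lt_two, mul_one]
  have hT : 1 ≤ T := by
    by_contra! h
    obtain rfl : T = 0 := by omega
    simp at key
  obtain ⟨t, rfl⟩ := Nat.exists_eq_add_of_le' hT
  obtain ⟨m, rfl⟩ := Nat.exists_eq_add_of_le' hm
  simp only [Nat.add_sub_cancel] at key
  have key' : (m : ℝ) < (j + 1) * t := by exact_mod_cast key
  have hj0 : (0 : ℝ) ≤ j := Nat.cast_nonneg j
  have ht0 : (0 : ℝ) ≤ t := Nat.cast_nonneg t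
  rw [hlogn]
  push_cast
  rw [add_sub_cancel_right, gt_iff_lt, add_lt_add_iff_right, div_lt_iff₀ (by linarith)]
  nlinarith

end Algorithm
end CliqueElection

/-! ### The theorem -/

theorem mainTheorem1 :
    ∃ (N₀ : ℕ) (c : ℝ), 0 < c ∧
      ∀ n : ℕ, N₀ ≤ n → (∃ m : ℕ, n = 2 ^ m) →
      ∀ U : Set ℤ, ((2 * n * Nat.log 2 n + n : ℕ) : ℕ∞) ≤ U.encard →
      ∀ A : CliqueElection.Algorithm n,
        (∀ (f : ℕ → ℝ) (T : ℕ), 1 < f n → A.ElectsLeaderIn U T →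
          (∀ (ids : Fin n → ℤ) (p : CliqueElection.PortMapping n),
            CliqueElection.ValidIDs U ids → (A.messages ids p T : ℝ) ≤ n * f n) →
          (T : ℝ) > (Real.logb 2 n - 1) / (Real.logb 2 (f n) + 1) + 1) ∧
        (∀ k : ℕ, 2 ≤ k → A.ElectsLeaderIn U k →
          ∃ (ids : Fin n → ℤ) (p : CliqueElection.PortMapping n),
            CliqueElection.ValidIDs U ids ∧
              c * ((n : ℝ) / 2) ^ (1 + 1 / ((k : ℝ) - 1)) ≤ (A.messages ids p k : ℝ)) := by
  refine ⟨2, 1 / 2, by norm_num, ?_⟩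
  rintro n hn ⟨m, hnm⟩ U hU A
  have hm : 1 ≤ m := by
    by_contra! h
    obtain rfl : m = 0 := by omega
    simp at hnm
    omega
  have hlog : Nat.log 2 n = m := by rw [hnm, Nat.log_pow one_lt_two]
  rw [hlog] at hU
  obtain ⟨Y, hYU, hY⟩ := Set.exists_subset_encard_eq hU
  have hfin : Y.Finite := Set.finite_of_encard_eq_coe hY
  obtain ⟨X, rfl⟩ := hfin.exists_finset_coe
  rw [Set.encard_coe_eq_coe_finsetCard, Nat.cast_inj] at hY
  refine ⟨fun f T hf hA hmes => CliqueElection.Algorithm.rounds_gt hm hnm hYU hY.ge hf hA hmes, fun k hk hA => ?_⟩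
  have hn' : (2 : ℝ) ≤ n := by exact_mod_cast hn
  have hk' : (2 : ℝ) ≤ k := by exact_mod_cast hk
  set x : ℝ := ((n : ℝ) / 2) ^ (1 / ((k : ℝ) - 1)) with hx
  have hpow : ((n : ℝ) / 2) ^ (1 + 1 / ((k : ℝ) - 1)) = n / 2 * x := by
    rw [Real.rpow_add (by linarith), Real.rpow_one]
  rw [hpow]
  -- Part (1) will be used with `x / 2` for `f n`, which must exceed `1`. For `x ≤ 2` the claimed
  -- bound is at most `n / 2`, and the linear bound suffices.
  rcases le_or_gt x 2 with hx2 | hx2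
  · obtain ⟨ids, p, hval, hmes⟩ := CliqueElection.Algorithm.exists_linear_messages hn hYU (by nlinarith) hA
    refine ⟨ids, p, hval, ?_⟩
    have : (n : ℝ) ≤ 2 * A.messages ids p k := by exact_mod_cast hmes
    nlinarith
  · by_contra! hlt
    have key := CliqueElection.Algorithm.rounds_gt (f := x / 2) hm hnm hYU hY.ge (by linarith)
      hA fun ids p hval => by nlinarith [hlt ids p hval]
    -- The factor `1 / 2` in `x / 2` cancels the `+ 1`, so part (1) reads `k > (k - 1) + 1`.
    have hlx : Real.logb 2 (x / 2) + 1 = (Real.logb 2 n - 1) / (k - 1) := by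
      rw [Real.logb_div (by linarith) two_ne_zero, Real.logb_self_eq_one one_lt_two, hx,
        Real.logb_rpow_eq_mul_logb_of_pos (by linarith), Real.logb_div (by linarith) two_ne_zero,
        Real.logb_self_eq_one one_lt_two]
      ring
    have hpos : 0 < Real.logb 2 (x / 2) + 1 := by
      have := Real.logb_pos one_lt_two (show 1 < x / 2 by linarith)
      linarith
    rw [hlx] at key hpos
    have hk1 : (0 : ℝ) < k - 1 := by linarith
    have hne : Real.logb 2 n - 1 ≠ 0 := by
      intro h
      rw [h, zero_div] at hpos
      exact lt_irrefl _ hpos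
    rw [div_div_cancel₀ hne] at key
    linarith
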